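/- Let $d,k,m$ be natural numbers with $m\ge 1$. Let $\mathcal D$ be the distribution of a pair $(x,y)\in\mathbb R^d\times\{1,\dots,k\}$ such that the label $y$ has probabilities $\mathcal D_1,\dots,\mathcal D_k$ (nonnegative, summing to $1$) and, given $y$, the vector $x=(x_1,\dots,x_d)$ has law $\mathcal N_y$ with independent coordinates $x_i\sim N(\mu_{y,i},\sigma_{y,i}^2)$, $\sigma_{y,i}\ge 0$. Let $\hat\ell:\mathbb R^k\times\{1,\dots,k\}\to\mathbb R$ be such that for every $y$ the function $t\mapsto\hat\ell(t,y)$ is differentiable with $\|\nabla_t\hat\ell(t,y)\|\le g$ for all $t$ (Euclidean norm). For $W\in\mathbb R^{k\times d}$ put $\ell(W,x,y)=\hat\ell(Wx,y)$, $L_D(W)=\mathbb E_{(x,y)\sim\mathcal D}\,\ell(W,x,y)$ and, for a training set $S=((x_1,y_1),\dots,(x_m,y_m))$, $L_S(W)=\frac1m\sum_{i=1}^m\ell(W,x_i,y_i)$. Let $p$ be the Gaussian prior on $\mathbb R^{k\times d}$ under which all entries of $W$ are independent $N(0,\sigma_p^2)$, with $\sigma_p>0$. Let $\lambda>0$ satisfy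 $\lambda\, g\,\sigma_p\,\sigma_{y,i}\le\sqrt{m/16}$ for all $y$ and $i$ (that is, $\lambda\le\sqrt{m/16}/(g\sigma_p\max_{y,i}\sigma_{y,i})$ when the denominator is positive). Assume that the loss is balanced across labels: for every $W$ and every $\alpha\in(0,\lambda/m]$ there is a constant $c=c(W,\alpha)$ such that $\mathbb E_{x\sim\mathcal N_y}\big[e^{-\alpha\ell(W,x,y)}\big]=c$ for all labels $y$. Let $\delta\in(0,1)$. Then $\ell(W,\cdot,\cdot)$ is $\mathcal D$-integrable for every $W$, and with probability at least $1-\delta$ over the draw of $S\sim\mathcal D^m$ the following holds simultaneously for all probability measures $q$ on $\mathbb R^{k\times d}$ with $\mathrm{KL}(q\|p)<\infty$ (the bound being vacuous otherwise): $L_D$ and $L_S$ are $q$-integrable, and $$\mathbb E_{W\sim q}[L_D(W)]\le\mathbb E_{W\sim q}[L_S(W)]+\frac{kd\,\log\sqrt{4/3}+\mathrm{KL}(q\|p)+\log(1/\delta)}{\lambda}.$$ -/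

import Mathlib

open MeasureTheory ProbabilityTheory
open scoped NNReal ENNReal Gradient

noncomputable section

/-- The Gaussian law on `ℝ^d` with independent coordinates `x_i ∼ N(μ_i, σ_i²)`;
`σ i` is the standard deviation of the `i`-th coordinate. -/
def diagGaussian {d : ℕ} (μ : Fin d → ℝ) (σ : Fin d → ℝ≥0) : Measure (Fin d → ℝ) :=
  Measure.pi fun i => gaussianReal (μ i) (σ i ^ 2)

/-- The data distribution on pairs `(x, y)`: the label `y` has law `P`, and given `y` the instance
`x` has law `N_y = N(μ_y, σ_y²)`. -/
def mixtureDist {d k : ℕ} (P : PMF (Fin k)) (μ : Fin k → Fin d → ℝ) (σ : Fin k → Fin d → ℝ≥0) :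
    Measure ((Fin d → ℝ) × Fin k) :=
  ∑ y, P y • (diagGaussian (μ y) (σ y)).map (fun x => (x, y))

/-- The prior on `k × d` weight arrays: all entries are independent `N(0, σp²)`. -/
def gaussianPrior (k d : ℕ) (σp : ℝ≥0) : Measure (Fin k → Fin d → ℝ) :=
  Measure.pi fun _ => Measure.pi fun _ => gaussianReal 0 (σp ^ 2)

/-- The loss `ℓ(W, x, y) = ℓ̂(W x, y)` of the linear model with weight matrix `W`. -/
def linearLoss {d k : ℕ} (lhat : EuclideanSpace ℝ (Fin k) → Fin k → ℝ)
    (W : Fin k → Fin d → ℝ) (x : Fin d → ℝ) (y : Fin k) : ℝ :=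
  lhat (WithLp.toLp 2 (Matrix.mulVec (Matrix.of W) x)) y

/-- The risk `L_D(W) = E_{(x,y) ∼ D} ℓ(W, x, y)`. -/
def risk {d k : ℕ} (lhat : EuclideanSpace ℝ (Fin k) → Fin k → ℝ)
    (D : Measure ((Fin d → ℝ) × Fin k)) (W : Fin k → Fin d → ℝ) : ℝ :=
  ∫ z, linearLoss lhat W z.1 z.2 ∂D

/-- The empirical risk `L_S(W) = (1/m) ∑ i, ℓ(W, x_i, y_i)`. -/
def empRisk {d k m : ℕ} (lhat : EuclideanSpace ℝ (Fin k) → Fin k → ℝ)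
    (S : Fin m → (Fin d → ℝ) × Fin k) (W : Fin k → Fin d → ℝ) : ℝ :=
  (1 / (m : ℝ)) * ∑ i, linearLoss lhat W (S i).1 (S i).2

/-- The loss per label is balanced at `α`: the value `E_{x ∼ N_y} [exp (-α ℓ(W, x, y))]`
is the same for all labels `y`. -/
def PerLabelBalanced {d k : ℕ} (lhat : EuclideanSpace ℝ (Fin k) → Fin k → ℝ)
    (μ : Fin k → Fin d → ℝ) (σ : Fin k → Fin d → ℝ≥0) (α : ℝ) : Prop :=
  ∀ W : Fin k → Fin d → ℝ, ∃ c : ℝ, ∀ y,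
    ∫ x, Real.exp (-α * linearLoss lhat W x y) ∂(diagGaussian (μ y) (σ y)) = c

end

/-! This is a PAC-Bayes bound: Donsker–Varadhan (`integral_le_klDiv_add_log_integral_exp`), applied
to `lam` times the generalization gap, pays `KL(q‖p)` and leaves the logarithm of an exponential
moment under the prior. That moment depends on `S` but not on `q`, so one application of Tonelli and
Markov (`exists_measurableSet_log_integral_exp_le`) serves all posteriors at once, at the price `log
(1 / δ)`.

It remains to bound the moment over `S` for fixed `W`. By independence it is a power of a one-sample
moment with `α = lam / m`. Given the label, the loss is Lipschitz in each Gaussian coordinate, with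
constant `g` times the norm of a column of `W`, so `integral_exp_le_pi_gaussianReal` gives `log c ≤
-α E_y + C ‖W‖²` (Frobenius norm), where `E_y` is the mean loss given `y`. Balance makes the left
side independent of `y`; averaging over labels turns `E_y` into the risk, so the spread of the `E_y`
costs nothing (`integral_exp_risk_sub_linearLoss_le`).

The condition on `lam` permits `m C = 1 / (8 σp²)`, and the prior then integrates `exp (m C ‖W‖²)`
to `√(4/3)` per entry of `W`. -/

/-- Young's inequality for the conjugate pair `r log r - r` and `exp`. -/
lemma mul_le_mul_log_sub_add_exp {r : ℝ} (hr : 0 ≤ r) (t : ℝ) :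
    r * t ≤ r * Real.log r - r + Real.exp t := by
  rcases hr.eq_or_lt with rfl | hr
  · simp [Real.exp_nonneg]
  -- The tangent-line bound for `exp` at `t - log r`, multiplied by `r`.
  · have h := Real.add_one_le_exp (t - Real.log r)
    rw [Real.exp_sub, Real.exp_log hr, le_div_iff₀ hr] at h
    linarith

/-! ### Change of measure by relative entropy -/

section DonskerVaradhan

variable {α : Type*} {mα : MeasurableSpace α} {q p : Measure α}
  [IsProbabilityMeasure q] [IsProbabilityMeasure p] {φ : α → ℝ}

/-- A function with integrable exponential moment under `p` is integrable under every measure of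
finite relative entropy with respect to `p`. -/
lemma integrable_of_klDiv_ne_top (hkl : InformationTheory.klDiv q p ≠ ∞)
    (hφ : AEStronglyMeasurable φ p) (hexp : Integrable (fun x => Real.exp |φ x|) p) :
    Integrable φ q := by
  obtain ⟨hac, hllr⟩ := InformationTheory.klDiv_ne_top_iff.1 hkl
  rw [← integrable_rnDeriv_smul_iff hac]
  have hlog := (integrable_rnDeriv_mul_log_iff hac).2 hllr
  have hr : Integrable (fun x => (q.rnDeriv p x).toReal) p := Measure.integrable_toReal_rnDeriv
  -- Young's inequality with `t = |φ|` dominates the density times `|φ|`.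
  refine Integrable.mono' ((hlog.sub hr).add hexp) (hr.aestronglyMeasurable.smul hφ) ?_
  refine Filter.Eventually.of_forall fun x => ?_
  simp only [smul_eq_mul, norm_mul, Real.norm_eq_abs, ENNReal.abs_toReal, Pi.add_apply,
    Pi.sub_apply]
  exact mul_le_mul_log_sub_add_exp ENNReal.toReal_nonneg _

/-- The Donsker–Varadhan inequality. -/
lemma integral_le_klDiv_add_log_integral_exp (hkl : InformationTheory.klDiv q p ≠ ∞)
    (hφ : Integrable φ q) (hexp : Integrable (fun x => Real.exp (φ x)) p) :
    ∫ x, φ x ∂q ≤ (InformationTheory.klDiv q p).toReal + Real.log (∫ x, Real.exp (φ x) ∂p) := by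
  obtain ⟨hac, hllr⟩ := InformationTheory.klDiv_ne_top_iff.1 hkl
  have hlog := (integrable_rnDeriv_mul_log_iff hac).2 hllr
  have hr : Integrable (fun x => (q.rnDeriv p x).toReal) p := Measure.integrable_toReal_rnDeriv
  have hZ : 0 < ∫ x, Real.exp (φ x) ∂p := integral_exp_pos hexp
  set Z := ∫ x, Real.exp (φ x) ∂p
  have hφ' : Integrable (fun x => φ x - Real.log Z) q := hφ.sub (integrable_const _)
  have hd : Integrable (fun x => (q.rnDeriv p x).toReal * Real.log (q.rnDeriv p x).toReal
      - (q.rnDeriv p x).toReal) p := hlog.sub hr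
  -- Young's inequality with `t = φ - log Z`: `exp φ / Z` has integral one and cancels the integral
  -- of the density.
  have key : ∫ x, (q.rnDeriv p x).toReal * (φ x - Real.log Z) ∂p ≤
      ∫ x, (((q.rnDeriv p x).toReal * Real.log (q.rnDeriv p x).toReal
        - (q.rnDeriv p x).toReal) + Real.exp (φ x) / Z) ∂p := by
    refine integral_mono ((integrable_rnDeriv_smul_iff hac).2 hφ')
      (hd.add (hexp.div_const _)) fun x => ?_
    have h := mul_le_mul_log_sub_add_exp (r := (q.rnDeriv p x).toReal)
      ENNReal.toReal_nonneg (φ x - Real.log Z)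
    rwa [Real.exp_sub, Real.exp_log hZ] at h
  rw [integral_add hd (hexp.div_const _), integral_sub hlog hr, integral_div,
    div_self hZ.ne', Measure.integral_toReal_rnDeriv hac] at key
  have e1 : ∫ x, (q.rnDeriv p x).toReal * (φ x - Real.log Z) ∂p = ∫ x, (φ x - Real.log Z) ∂q :=
    integral_rnDeriv_smul hac
  have e2 : ∫ x, (q.rnDeriv p x).toReal * Real.log (q.rnDeriv p x).toReal ∂p =
      ∫ x, llr q p x ∂q := integral_rnDeriv_smul hac
  rw [e1, e2, integral_sub hφ (integrable_const _)] at key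
  rw [InformationTheory.toReal_klDiv_of_measure_eq hac (by simp)]
  simp at key
  linarith

end DonskerVaradhan

/-! ### One-dimensional Gaussian moments -/

section Gaussian

lemma integrable_exp_mul_abs_gaussianReal (m : ℝ) (v : ℝ≥0) (c : ℝ) :
    Integrable (fun x => Real.exp (c * |x|)) (gaussianReal m v) :=
  integrable_exp_mul_abs (integrable_exp_mul_gaussianReal c) (integrable_exp_mul_gaussianReal (-c))

lemma integrable_abs_gaussianReal (m : ℝ) (v : ℝ≥0) :
    Integrable (fun x => |x|) (gaussianReal m v) :=
  ((memLp_id_gaussianReal (μ := m) (v := v) 1).integrable (by simp)).abs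

/-- A Lipschitz function of a real Gaussian variable is sub-Gaussian. -/
lemma integral_exp_le_gaussianReal (m : ℝ) (v : ℝ≥0) {h : ℝ → ℝ} {L : ℝ}
    (hL : ∀ x y, |h x - h y| ≤ L * |x - y|)
    (hi : Integrable h (gaussianReal m v))
    (hp : Integrable (fun x => Real.exp (h x)) (gaussianReal m v))
    (hn : Integrable (fun x => Real.exp (-h x)) (gaussianReal m v)) :
    ∫ x, Real.exp (h x) ∂(gaussianReal m v) ≤
      Real.exp (∫ x, h x ∂(gaussianReal m v) + L ^ 2 * v) := by
  set ν := gaussianReal m v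
  have hpos := integrable_exp_mul_gaussianReal (μ := m) (v := v) L
  have hneg := integrable_exp_mul_gaussianReal (μ := m) (v := v) (-L)
  have mgf (t : ℝ) : ∫ x, Real.exp (t * x) ∂ν = Real.exp (m * t + v * t ^ 2 / 2) :=
    congrFun (mgf_fun_id_gaussianReal (μ := m) (v := v)) t
  have jensen : Real.exp (-∫ x, h x ∂ν) ≤ ∫ x, Real.exp (-h x) ∂ν := by
    rw [← integral_neg]
    exact convexOn_exp.map_integral_le Real.continuous_exp.continuousOn isClosed_univ
      (by simp) hi.neg hn
  -- Symmetrization with an independent copy: `cosh` is even and increasing in the absolute value,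
  -- so the Lipschitz bound replaces `h` by a linear function, whose moments are explicit. Jensen
  -- then removes the factor `E exp (-h)`.
  have sym : ∫ z : ℝ × ℝ, (Real.exp (h z.1) * Real.exp (-h z.2)
        + Real.exp (-h z.1) * Real.exp (h z.2)) ∂(ν.prod ν) ≤
      ∫ z : ℝ × ℝ, (Real.exp (L * z.1) * Real.exp (-L * z.2)
        + Real.exp (-L * z.1) * Real.exp (L * z.2)) ∂(ν.prod ν) := by
    refine integral_mono ((hp.mul_prod hn).add (hn.mul_prod hp))
      ((hpos.mul_prod hneg).add (hneg.mul_prod hpos)) fun z => ?_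
    have hc : Real.cosh (h z.1 - h z.2) ≤ Real.cosh (L * (z.1 - z.2)) := by
      rw [Real.cosh_le_cosh, abs_mul]
      exact (hL _ _).trans (by gcongr; exact le_abs_self L)
    rw [Real.cosh_eq, Real.cosh_eq] at hc
    simp only [← Real.exp_add]
    rw [show -h z.1 + h z.2 = -(h z.1 - h z.2) by ring,
      show L * z.1 + -L * z.2 = L * (z.1 - z.2) by ring,
      show -L * z.1 + L * z.2 = -(L * (z.1 - z.2)) by ring, ← sub_eq_add_neg]
    linarith
  rw [integral_add (hp.mul_prod hn) (hn.mul_prod hp),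
    integral_add (hpos.mul_prod hneg) (hneg.mul_prod hpos),
    integral_prod_mul (fun x => Real.exp (h x)) (fun x => Real.exp (-h x)),
    integral_prod_mul (fun x => Real.exp (-h x)) (fun x => Real.exp (h x)),
    integral_prod_mul (fun x => Real.exp (L * x)) (fun x => Real.exp (-L * x)),
    integral_prod_mul (fun x => Real.exp (-L * x)) (fun x => Real.exp (L * x)),
    mgf, mgf, ← Real.exp_add, ← Real.exp_add] at sym
  have e : m * L + v * L ^ 2 / 2 + (m * -L + v * (-L) ^ 2 / 2) = L ^ 2 * v := by ring
  have e' : m * -L + v * (-L) ^ 2 / 2 + (m * L + v * L ^ 2 / 2) = L ^ 2 * v := by ring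
  rw [e, e'] at sym
  have h0 : 0 ≤ ∫ x, Real.exp (h x) ∂ν := integral_nonneg fun x => (Real.exp_pos _).le
  have h1 := mul_le_mul_of_nonneg_left jensen h0
  rw [Real.exp_add, ← div_le_iff₀' (Real.exp_pos _), div_eq_mul_inv, ← Real.exp_neg]
  linarith

/-- `E exp (x² / (8 v)) = √(4/3)` for `x ∼ N(0, v)`. -/
lemma integral_exp_sq_gaussianReal {v : ℝ≥0} (hv : v ≠ 0) :
    Integrable (fun x => Real.exp (x ^ 2 / (8 * v))) (gaussianReal 0 v) ∧
    ∫ x, Real.exp (x ^ 2 / (8 * v)) ∂(gaussianReal 0 v) = Real.sqrt (4 / 3) := by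
  have hv' : (0 : ℝ) < v := by positivity
  have e : ∀ x : ℝ, gaussianPDFReal 0 v x * Real.exp (x ^ 2 / (8 * v)) =
      (Real.sqrt (2 * Real.pi * v))⁻¹ * Real.exp (-(3 / (8 * v)) * x ^ 2) := by
    intro x
    rw [gaussianPDFReal, mul_assoc, ← Real.exp_add]
    congr 2
    field_simp
    ring
  have hI : ∫ x, Real.exp (x ^ 2 / (8 * v)) ∂(gaussianReal 0 v) = Real.sqrt (4 / 3) := by
    rw [integral_gaussianReal_eq_integral_smul hv]
    simp only [smul_eq_mul, e]
    rw [integral_const_mul, integral_gaussian, ← Real.sqrt_inv, ← Real.sqrt_mul (by positivity)]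
    congr 1
    field_simp
    ring
  refine ⟨?_, hI⟩
  -- A non-integrable function would have integral zero by convention, but the value found is
  -- positive.
  by_contra hn
  rw [integral_undef hn] at hI
  have : 0 < Real.sqrt (4 / 3) := by positivity
  linarith

end Gaussian

/-! ### Coordinatewise Lipschitz functions of independent Gaussians -/

section WeightedLipschitz

variable {d : ℕ} {L : Fin d → ℝ} {f : (Fin d → ℝ) → ℝ}

lemma continuous_of_abs_sub_le_sum (hf : ∀ x y, |f x - f y| ≤ ∑ i, L i * |x i - y i|) :
    Continuous f := by
  rw [continuous_iff_continuousAt]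
  intro y
  rw [ContinuousAt, tendsto_iff_dist_tendsto_zero]
  refine squeeze_zero (fun _ => dist_nonneg) (fun x => hf x y) ?_
  have : Continuous fun x : Fin d → ℝ => ∑ i, L i * |x i - y i| := by fun_prop
  have h := this.tendsto y
  simp only [sub_self, abs_zero, mul_zero, Finset.sum_const_zero] at h
  exact h

lemma abs_le_of_abs_sub_le_sum (hf : ∀ x y, |f x - f y| ≤ ∑ i, L i * |x i - y i|)
    (x : Fin d → ℝ) : |f x| ≤ |f 0| + ∑ i, L i * |x i| := by
  have h := hf x 0
  simp only [Pi.zero_apply, sub_zero] at h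
  have := abs_sub_abs_le_abs_sub (f x) (f 0)
  linarith

lemma integrable_of_abs_sub_le_sum (m : Fin d → ℝ) (v : Fin d → ℝ≥0)
    (hf : ∀ x y, |f x - f y| ≤ ∑ i, L i * |x i - y i|) :
    Integrable f (Measure.pi fun i => gaussianReal (m i) (v i)) := by
  refine Integrable.mono' (g := fun x => |f 0| + ∑ i, L i * |x i|) ?_
    (continuous_of_abs_sub_le_sum hf).aestronglyMeasurable
    (Filter.Eventually.of_forall fun x => abs_le_of_abs_sub_le_sum hf x)
  refine (integrable_const _).add (integrable_finsetSum _ fun i _ => Integrable.const_mul ?_ _)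
  exact integrable_comp_eval (μ := fun i => gaussianReal (m i) (v i)) (f := fun t : ℝ => |t|)
    (integrable_abs_gaussianReal _ _)

lemma integrable_exp_of_abs_sub_le_sum (m : Fin d → ℝ) (v : Fin d → ℝ≥0)
    (hf : ∀ x y, |f x - f y| ≤ ∑ i, L i * |x i - y i|) :
    Integrable (fun x => Real.exp (f x)) (Measure.pi fun i => gaussianReal (m i) (v i)) := by
  refine Integrable.mono' (g := fun x => Real.exp |f 0| * ∏ i, Real.exp (L i * |x i|)) ?_
    (Real.continuous_exp.comp (continuous_of_abs_sub_le_sum hf)).aestronglyMeasurable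
    (Filter.Eventually.of_forall fun x => ?_)
  · exact (Integrable.fintype_prod (f := fun i t => Real.exp (L i * |t|)) fun i =>
      integrable_exp_mul_abs_gaussianReal _ _ _).const_mul _
  · rw [← Real.exp_sum, ← Real.exp_add, Real.norm_eq_abs, Real.abs_exp]
    exact Real.exp_le_exp.2 ((le_abs_self _).trans (abs_le_of_abs_sub_le_sum hf x))

end WeightedLipschitz

/-- Sub-Gaussian bound for functions of independent Gaussians that are Lipschitz in each
coordinate. -/
lemma integral_exp_le_pi_gaussianReal {d : ℕ} (m : Fin d → ℝ) (v : Fin d → ℝ≥0) (L : Fin d → ℝ)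
    (f : (Fin d → ℝ) → ℝ) (hf : ∀ x y, |f x - f y| ≤ ∑ i, L i * |x i - y i|) :
    ∫ x, Real.exp (f x) ∂(Measure.pi fun i => gaussianReal (m i) (v i)) ≤
      Real.exp (∫ x, f x ∂(Measure.pi fun i => gaussianReal (m i) (v i)) + ∑ i, L i ^ 2 * v i) := by
  induction d with
  | zero =>
    have : f = fun _ => f 0 := funext fun x => congrArg f (Subsingleton.elim _ _)
    rw [this]
    simp
  | succ d ih =>
    set ν := Measure.pi fun i : Fin (d + 1) => gaussianReal (m i) (v i)
    set ν₀ := gaussianReal (m 0) (v 0)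
    set ν₁ := Measure.pi fun i : Fin d => gaussianReal (m i.succ) (v i.succ)
    have hcons : (fun z : ℝ × (Fin d → ℝ) => (Fin.cons z.1 z.2 : Fin (d + 1) → ℝ)) =
        (MeasurableEquiv.piFinSuccAbove (fun _ : Fin (d + 1) => ℝ) 0).symm := by
      funext z i
      refine Fin.cases ?_ (fun j => ?_) i <;>
        simp [MeasurableEquiv.piFinSuccAbove_symm_apply, Fin.insertNthEquiv]
    have mp : MeasurePreserving (fun z : ℝ × (Fin d → ℝ) => (Fin.cons z.1 z.2 : Fin (d + 1) → ℝ))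
        (ν₀.prod ν₁) ν := by
      rw [hcons]
      exact (measurePreserving_piFinSuccAbove
        (fun i : Fin (d + 1) => gaussianReal (m i) (v i)) 0).symm
    have emb : MeasurableEmbedding
        (fun z : ℝ × (Fin d → ℝ) => (Fin.cons z.1 z.2 : Fin (d + 1) → ℝ)) := by
      rw [hcons]
      exact MeasurableEquiv.measurableEmbedding _
    have hfi : Integrable (fun z : ℝ × (Fin d → ℝ) => f (Fin.cons z.1 z.2)) (ν₀.prod ν₁) :=
      (mp.integrable_comp_emb emb).2 (integrable_of_abs_sub_le_sum m v hf)
    have hei : Integrable (fun z : ℝ × (Fin d → ℝ) => Real.exp (f (Fin.cons z.1 z.2)))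
        (ν₀.prod ν₁) :=
      (mp.integrable_comp_emb emb).2 (integrable_exp_of_abs_sub_le_sum m v hf)
    have hsec (a : ℝ) (x y : Fin d → ℝ) : |f (Fin.cons a x) - f (Fin.cons a y)| ≤
        ∑ i, L i.succ * |x i - y i| := by
      have := hf (Fin.cons a x) (Fin.cons a y)
      simpa [Fin.sum_univ_succ] using this
    have hsi (a : ℝ) : Integrable (fun x => f (Fin.cons a x)) ν₁ :=
      integrable_of_abs_sub_le_sum _ _ (hsec a)
    -- Integrating out all but the first coordinate keeps the Lipschitz constant `L 0`. The
    -- induction hypothesis handles each slice, and the one-dimensional bound handles `F`.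
    set F : ℝ → ℝ := fun a => ∫ x, f (Fin.cons a x) ∂ν₁ with hF
    have hFL (a b : ℝ) : |F a - F b| ≤ L 0 * |a - b| := by
      rw [hF, ← integral_sub (hsi a) (hsi b)]
      have hb := norm_integral_le_of_norm_le_const (μ := ν₁)
        (f := fun x : Fin d → ℝ => f (Fin.cons a x) - f (Fin.cons b x)) (C := L 0 * |a - b|)
        (Filter.Eventually.of_forall fun x => by
          have := hf (Fin.cons a x) (Fin.cons b x)
          simpa [Fin.sum_univ_succ] using this)
      simpa using hb
    have hFabs (a : ℝ) : |F a| ≤ |F 0| + L 0 * |a| := by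
      have h := hFL a 0
      rw [sub_zero] at h
      have := abs_sub_abs_le_abs_sub (F a) (F 0)
      linarith
    have hFint : Integrable F ν₀ := hfi.integral_prod_left
    have hFexp (s : ℝ) (hs : |s| = 1) : Integrable (fun a => Real.exp (s * F a)) ν₀ := by
      refine Integrable.mono' (g := fun a => Real.exp |F 0| * Real.exp (L 0 * |a|))
        ((integrable_exp_mul_abs_gaussianReal _ _ _).const_mul _)
        (Real.continuous_exp.comp_aestronglyMeasurable (hFint.aestronglyMeasurable.const_mul _))
        (Filter.Eventually.of_forall fun a => ?_)
      rw [← Real.exp_add, Real.norm_eq_abs, Real.abs_exp]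
      refine Real.exp_le_exp.2 ((le_abs_self _).trans ?_)
      rw [abs_mul, hs, one_mul]
      exact hFabs a
    calc ∫ x, Real.exp (f x) ∂ν
        = ∫ a, ∫ x, Real.exp (f (Fin.cons a x)) ∂ν₁ ∂ν₀ := by
          rw [← integral_prod _ hei]
          exact (mp.integral_comp emb fun x => Real.exp (f x)).symm
      _ ≤ ∫ a, Real.exp (F a) * Real.exp (∑ i : Fin d, L i.succ ^ 2 * v i.succ) ∂ν₀ := by
          refine integral_mono hei.integral_prod_left ?_ fun a => ?_
          · simpa using (hFexp 1 (by simp)).mul_const _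
          · rw [← Real.exp_add]
            exact ih _ _ (fun i => L i.succ) _ (hsec a)
      _ = (∫ a, Real.exp (F a) ∂ν₀) * Real.exp (∑ i : Fin d, L i.succ ^ 2 * v i.succ) :=
          integral_mul_const _ _
      _ ≤ Real.exp (∫ a, F a ∂ν₀ + L 0 ^ 2 * v 0)
            * Real.exp (∑ i : Fin d, L i.succ ^ 2 * v i.succ) := by
          gcongr
          exact integral_exp_le_gaussianReal _ _ hFL hFint (by simpa using hFexp 1 (by simp))
            (by simpa using hFexp (-1) (by simp))
      _ = Real.exp (∫ x, f x ∂ν + ∑ i, L i ^ 2 * v i) := by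
          rw [← Real.exp_add, Fin.sum_univ_succ, add_assoc, hF, ← integral_prod _ hfi]
          congr 2
          exact mp.integral_comp emb f

lemma abs_sub_le_of_norm_gradient_le {E : Type*} [NormedAddCommGroup E] [InnerProductSpace ℝ E]
    [CompleteSpace E] {f : E → ℝ} {g : ℝ} (hf : Differentiable ℝ f) (hg : ∀ t, ‖∇ f t‖ ≤ g)
    (s t : E) : |f s - f t| ≤ g * ‖s - t‖ := by
  have := Convex.norm_image_sub_le_of_norm_fderiv_le (𝕜 := ℝ) (f := f) (s := Set.univ) (C := g)
    (fun x _ => hf x) (fun x _ => by simpa [gradient] using hg x) convex_univ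
    (Set.mem_univ t) (Set.mem_univ s)
  simpa using this

/-! ### From a moment bound to a high-probability event -/

/-- A uniform exponential moment bound holds with high probability after averaging over a prior. -/
lemma exists_measurableSet_log_integral_exp_le {Ω 𝓦 : Type*} {mΩ : MeasurableSpace Ω}
    {m𝓦 : MeasurableSpace 𝓦} (ρ : Measure Ω) [IsProbabilityMeasure ρ] (p : Measure 𝓦)
    [IsProbabilityMeasure p] {Δ : Ω → 𝓦 → ℝ} (hΔ : Measurable (Function.uncurry Δ))
    {b : 𝓦 → ℝ} (hb : Integrable b p) (hint : ∀ W, Integrable (fun S => Real.exp (Δ S W)) ρ)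
    (hle : ∀ W, ∫ S, Real.exp (Δ S W) ∂ρ ≤ b W) {δ : ℝ} (hδ : 0 < δ) :
    ∃ G : Set Ω, MeasurableSet G ∧ ENNReal.ofReal (1 - δ) ≤ ρ G ∧ ∀ S ∈ G,
      Integrable (fun W => Real.exp (Δ S W)) p ∧
      Real.log (∫ W, Real.exp (Δ S W) ∂p) ≤ Real.log ((∫ W, b W ∂p) / δ) := by
  have hm : Measurable fun z : Ω × 𝓦 => ENNReal.ofReal (Real.exp (Δ z.1 z.2)) :=
    (Real.measurable_exp.comp hΔ).ennreal_ofReal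
  set B := ∫ W, b W ∂p
  have hbpos (W : 𝓦) : 0 < b W := (integral_exp_pos (hint W)).trans_le (hle W)
  have hB : 0 < B := by
    rw [integral_pos_iff_support_of_nonneg (fun W => (hbpos W).le) hb,
      Set.eq_univ_of_forall (s := Function.support b) fun W => (hbpos W).ne']
    simp
  -- Taken in `ℝ≥0∞`, since integrability in `W` is not known for every `S`; on the good event it
  -- follows from finiteness.
  set ξ : Ω → ℝ≥0∞ := fun S => ∫⁻ W, ENNReal.ofReal (Real.exp (Δ S W)) ∂p
  have hξ : Measurable ξ := hm.lintegral_prod_right'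
  have hmean : ∫⁻ S, ξ S ∂ρ ≤ ENNReal.ofReal B := by
    calc ∫⁻ S, ξ S ∂ρ = ∫⁻ W, ∫⁻ S, ENNReal.ofReal (Real.exp (Δ S W)) ∂ρ ∂p :=
          lintegral_lintegral_swap hm.aemeasurable
      _ ≤ ∫⁻ W, ENNReal.ofReal (b W) ∂p := by
          refine lintegral_mono fun W => ?_
          rw [← ofReal_integral_eq_lintegral_ofReal (hint W)
            (Filter.Eventually.of_forall fun S => (Real.exp_pos _).le)]
          exact ENNReal.ofReal_le_ofReal (hle W)
      _ = ENNReal.ofReal B := (ofReal_integral_eq_lintegral_ofReal hb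
          (Filter.Eventually.of_forall fun W => (hbpos W).le)).symm
  have hbad : ρ {S | ENNReal.ofReal (B / δ) ≤ ξ S} ≤ ENNReal.ofReal δ := by
    -- Markov's inequality at level `B / δ`.
    have h := (mul_meas_ge_le_lintegral (μ := ρ) hξ (ENNReal.ofReal (B / δ))).trans hmean
    have hpos : 0 < B / δ := by positivity
    rw [mul_comm, ← ENNReal.le_div_iff_mul_le (by simp [hpos]) (by simp),
      ← ENNReal.ofReal_div_of_pos hpos] at h
    rwa [div_div_cancel₀ hB.ne'] at h
  refine ⟨{S | ENNReal.ofReal (B / δ) ≤ ξ S}ᶜ, (measurableSet_le measurable_const hξ).compl,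
    ?_, fun S hS => ?_⟩
  · rw [prob_compl_eq_one_sub (measurableSet_le measurable_const hξ), ENNReal.ofReal_sub _ hδ.le,
      ENNReal.ofReal_one]
    exact tsub_le_tsub_left hbad _
  · have hS' : ξ S < ENNReal.ofReal (B / δ) := not_le.1 hS
    have hmS : Measurable fun W => Real.exp (Δ S W) :=
      Real.measurable_exp.comp (hΔ.comp measurable_prodMk_left)
    have hi : Integrable (fun W => Real.exp (Δ S W)) p := by
      refine ⟨hmS.aestronglyMeasurable, ?_⟩
      rw [hasFiniteIntegral_iff_ofReal (Filter.Eventually.of_forall fun W => (Real.exp_pos _).le)]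
      exact hS'.trans ENNReal.ofReal_lt_top
    refine ⟨hi, Real.log_le_log (integral_exp_pos hi) ?_⟩
    rw [← ENNReal.ofReal_le_ofReal_iff (by positivity), ofReal_integral_eq_lintegral_ofReal hi
      (Filter.Eventually.of_forall fun W => (Real.exp_pos _).le)]
    exact hS'.le

/-! ### Integration against the data distribution -/

section Mixture

variable {d k : ℕ} (P : PMF (Fin k)) (μ : Fin k → Fin d → ℝ) (σ : Fin k → Fin d → ℝ≥0)

instance instIsProbabilityMeasureDiagGaussian (a : Fin d → ℝ) (s : Fin d → ℝ≥0) :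
    IsProbabilityMeasure (diagGaussian a s) := by
  unfold diagGaussian; infer_instance

lemma PMF.sum_toReal_eq_one {ι : Type*} [Fintype ι] (P : PMF ι) : ∑ y, (P y).toReal = 1 := by
  rw [← ENNReal.toReal_sum fun y _ => P.apply_ne_top y, ← tsum_fintype (L := .unconditional _),
    P.tsum_coe, ENNReal.toReal_one]

instance instIsProbabilityMeasureMixtureDist : IsProbabilityMeasure (mixtureDist P μ σ) := by
  constructor
  have h (y : Fin k) : ((diagGaussian (μ y) (σ y)).map (fun x => (x, y))) Set.univ = 1 := by
    rw [Measure.map_apply measurable_prodMk_right MeasurableSet.univ]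
    simp
  simp only [mixtureDist, Measure.coe_finsetSum, Finset.sum_apply, Measure.smul_apply, h,
    smul_eq_mul, mul_one]
  rw [← tsum_fintype (L := .unconditional _), P.tsum_coe]

instance instIsProbabilityMeasureGaussianPrior (s : ℝ≥0) :
    IsProbabilityMeasure (gaussianPrior k d s) := by
  unfold gaussianPrior; infer_instance

variable {P μ σ} {h : (Fin d → ℝ) × Fin k → ℝ}

lemma integrable_mixtureDist
    (hh : ∀ y, Integrable (fun x => h (x, y)) (diagGaussian (μ y) (σ y))) :
    Integrable h (mixtureDist P μ σ) := by
  refine integrable_finsetSum_measure.2 fun y _ => ?_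
  exact ((measurableEmbedding_prod_mk_right y).integrable_map_iff.2 (hh y)).smul_measure
    (P.apply_ne_top y)

lemma integral_mixtureDist
    (hh : ∀ y, Integrable (fun x => h (x, y)) (diagGaussian (μ y) (σ y))) :
    ∫ z, h z ∂(mixtureDist P μ σ) =
      ∑ y, (P y).toReal * ∫ x, h (x, y) ∂(diagGaussian (μ y) (σ y)) := by
  rw [mixtureDist, integral_finsetSum_measure fun y _ =>
    ((measurableEmbedding_prod_mk_right y).integrable_map_iff.2 (hh y)).smul_measure
      (P.apply_ne_top y)]
  refine Finset.sum_congr rfl fun y _ => ?_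
  rw [integral_smul_measure, (measurableEmbedding_prod_mk_right y).integral_map, smul_eq_mul]

end Mixture

/-! ### Moments of the Gaussian prior -/

section Prior

variable {k d : ℕ} {s : ℝ≥0}

/-- Input for `integrable_of_klDiv_ne_top`: it makes each entry of `W` integrable under every
admissible posterior. -/
lemma integrable_exp_abs_entry (j : Fin k) (i : Fin d) :
    Integrable (fun W : Fin k → Fin d → ℝ => Real.exp |W j i|) (gaussianPrior k d s) := by
  have h := integrable_exp_mul_abs_gaussianReal 0 (s ^ 2) 1
  simp only [one_mul] at h
  have h1 : Integrable (fun w : Fin d → ℝ => Real.exp |w i|)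
      (Measure.pi fun _ => gaussianReal 0 (s ^ 2)) :=
    integrable_comp_eval (μ := fun _ : Fin d => gaussianReal 0 (s ^ 2))
      (f := fun t : ℝ => Real.exp |t|) h
  exact integrable_comp_eval (μ := fun _ : Fin k => Measure.pi fun _ => gaussianReal 0 (s ^ 2))
    (f := fun w : Fin d → ℝ => Real.exp |w i|) h1

lemma integral_exp_sum_sq_gaussianPrior (hs : 0 < s) :
    Integrable (fun W : Fin k → Fin d → ℝ => Real.exp (∑ j, ∑ i, W j i ^ 2 / (8 * (s : ℝ) ^ 2)))
      (gaussianPrior k d s) ∧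
    ∫ W, Real.exp (∑ j, ∑ i, W j i ^ 2 / (8 * (s : ℝ) ^ 2)) ∂(gaussianPrior k d s) =
      Real.sqrt (4 / 3) ^ (k * d) := by
  have h := integral_exp_sq_gaussianReal (v := s ^ 2) (by positivity)
  push_cast at h
  simp only [Real.exp_sum, gaussianPrior]
  constructor
  · exact Integrable.fintype_prod (f := fun _ (w : Fin d → ℝ) =>
      ∏ i, Real.exp (w i ^ 2 / (8 * (s : ℝ) ^ 2))) fun _ =>
        Integrable.fintype_prod (f := fun _ (t : ℝ) => Real.exp (t ^ 2 / (8 * (s : ℝ) ^ 2)))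
          fun _ => h.1
  · rw [integral_fintype_prod_eq_pow (fun w : Fin d → ℝ =>
      ∏ i, Real.exp (w i ^ 2 / (8 * (s : ℝ) ^ 2))), integral_fintype_prod_eq_pow
      (fun t : ℝ => Real.exp (t ^ 2 / (8 * (s : ℝ) ^ 2))), h.2, ← pow_mul]
    simp [mul_comm]

end Prior

/-! ### The linear model and its generalization gap -/

section LinearModel

variable {d k m : ℕ} {lhat : EuclideanSpace ℝ (Fin k) → Fin k → ℝ} {g : ℝ}

lemma linearLoss_zero_right (W : Fin k → Fin d → ℝ) (y : Fin k) :
    linearLoss lhat W 0 y = lhat 0 y := by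
  simp [linearLoss]

lemma measurable_linearLoss (hlhat : ∀ y, Continuous fun t => lhat t y) :
    Measurable fun z : (Fin k → Fin d → ℝ) × ((Fin d → ℝ) × Fin k) =>
      linearLoss lhat z.1 z.2.1 z.2.2 := by
  have h : Measurable fun z : ((Fin k → Fin d → ℝ) × (Fin d → ℝ)) × Fin k =>
      linearLoss lhat z.1.1 z.1.2 z.2 := by
    refine measurable_from_prod_countable_left fun y => ?_
    refine ((hlhat y).comp ((PiLp.continuous_toLp 2 _).comp ?_)).measurable
    exact continuous_pi fun j => by
      simp only [Matrix.mulVec, dotProduct, Matrix.of_apply]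
      fun_prop
  exact h.comp (((measurable_fst).prodMk measurable_snd.fst).prodMk measurable_snd.snd)

lemma measurable_risk (hlhat : ∀ y, Continuous fun t => lhat t y)
    (D : Measure ((Fin d → ℝ) × Fin k)) [SFinite D] : Measurable (risk lhat D) :=
  ((measurable_linearLoss hlhat).stronglyMeasurable.integral_prod_right' (ν := D)).measurable

lemma measurable_empRisk (hlhat : ∀ y, Continuous fun t => lhat t y) :
    Measurable fun z : (Fin m → (Fin d → ℝ) × Fin k) × (Fin k → Fin d → ℝ) =>
      empRisk lhat z.1 z.2 := by
  refine Measurable.const_mul (Finset.measurable_sum _ fun i _ => ?_) _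
  exact (measurable_linearLoss hlhat).comp
    (measurable_snd.prodMk ((measurable_pi_apply i).comp measurable_fst))

/-- The Euclidean norm of the `i`-th column of a weight array. -/
noncomputable def colNorm (W : Fin k → Fin d → ℝ) (i : Fin d) : ℝ :=
  ‖(WithLp.toLp 2 fun j => W j i : EuclideanSpace ℝ (Fin k))‖

lemma colNorm_sq (W : Fin k → Fin d → ℝ) (i : Fin d) : colNorm W i ^ 2 = ∑ j, W j i ^ 2 := by
  simp [colNorm, EuclideanSpace.norm_sq_eq]

/-- Passing to the sum of absolute values reduces integrability in `W` to single entries. -/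
lemma colNorm_le (W : Fin k → Fin d → ℝ) (i : Fin d) : colNorm W i ≤ ∑ j, |W j i| := by
  refine abs_le_of_sq_le_sq' ?_ (Finset.sum_nonneg fun j _ => abs_nonneg _) |>.2
  rw [colNorm_sq]
  calc ∑ j, W j i ^ 2 = ∑ j, |W j i| ^ 2 := by simp
    _ ≤ (∑ j, |W j i|) ^ 2 := Finset.sum_sq_le_sq_sum_of_nonneg fun j _ => abs_nonneg _

/-- `W x` is the combination of the columns of `W` with coefficients `x i`. The squared column norms
add up to the squared Frobenius norm, which the prior can integrate. -/
lemma norm_toLp_mulVec_le (W : Fin k → Fin d → ℝ) (x : Fin d → ℝ) :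
    ‖(WithLp.toLp 2 (Matrix.mulVec (Matrix.of W) x) : EuclideanSpace ℝ (Fin k))‖ ≤
      ∑ i, colNorm W i * |x i| := by
  have h : (WithLp.toLp 2 (Matrix.mulVec (Matrix.of W) x) : EuclideanSpace ℝ (Fin k)) =
      ∑ i, x i • WithLp.toLp 2 fun j => W j i := by
    ext j
    simp [Matrix.mulVec, dotProduct, mul_comm]
  rw [h]
  refine (norm_sum_le _ _).trans (Finset.sum_le_sum fun i _ => ?_)
  rw [norm_smul, Real.norm_eq_abs, mul_comm, colNorm]

lemma abs_linearLoss_sub_le (hg : 0 ≤ g) {y : Fin k}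
    (hlip : ∀ s t, |lhat s y - lhat t y| ≤ g * ‖s - t‖) (W : Fin k → Fin d → ℝ)
    (x x' : Fin d → ℝ) :
    |linearLoss lhat W x y - linearLoss lhat W x' y| ≤ ∑ i, g * colNorm W i * |x i - x' i| := by
  refine (hlip _ _).trans ?_
  rw [← WithLp.toLp_sub, ← Matrix.mulVec_sub]
  refine (mul_le_mul_of_nonneg_left (norm_toLp_mulVec_le W _) hg).trans_eq ?_
  simp [Finset.mul_sum, mul_assoc]

lemma abs_linearLoss_le (hg : 0 ≤ g) {y : Fin k}
    (hlip : ∀ s t, |lhat s y - lhat t y| ≤ g * ‖s - t‖) (W : Fin k → Fin d → ℝ)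
    (x : Fin d → ℝ) :
    |linearLoss lhat W x y| ≤ |lhat 0 y| + ∑ i, g * (∑ j, |W j i|) * |x i| := by
  have h := abs_le_of_abs_sub_le_sum (abs_linearLoss_sub_le hg hlip W) x
  rw [linearLoss_zero_right] at h
  refine h.trans (by gcongr; exact colNorm_le _ _)

variable {P : PMF (Fin k)} {μ : Fin k → Fin d → ℝ} {σ : Fin k → Fin d → ℝ≥0}

section Lipschitz

variable (hg : 0 ≤ g) (hlip : ∀ y s t, |lhat s y - lhat t y| ≤ g * ‖s - t‖)
include hg hlip

lemma integrable_linearLoss_diagGaussian (W : Fin k → Fin d → ℝ) (y : Fin k) :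
    Integrable (fun x => linearLoss lhat W x y) (diagGaussian (μ y) (σ y)) :=
  integrable_of_abs_sub_le_sum _ _ (abs_linearLoss_sub_le hg (hlip y) W)

lemma abs_neg_mul_linearLoss_sub_le {α : ℝ} (hα : 0 ≤ α) (W : Fin k → Fin d → ℝ) (y : Fin k)
    (x x' : Fin d → ℝ) :
    |-α * linearLoss lhat W x y - -α * linearLoss lhat W x' y| ≤
      ∑ i, α * (g * colNorm W i) * |x i - x' i| := by
  rw [← mul_sub, abs_mul, abs_neg, abs_of_nonneg hα]
  refine (mul_le_mul_of_nonneg_left (abs_linearLoss_sub_le hg (hlip y) W x x') hα).trans_eq ?_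
  simp [Finset.mul_sum, mul_assoc]

lemma integrable_exp_linearLoss_diagGaussian {α : ℝ} (hα : 0 ≤ α) (W : Fin k → Fin d → ℝ)
    (y : Fin k) :
    Integrable (fun x => Real.exp (-α * linearLoss lhat W x y)) (diagGaussian (μ y) (σ y)) :=
  integrable_exp_of_abs_sub_le_sum _ _ (abs_neg_mul_linearLoss_sub_le hg hlip hα W y)

lemma integrable_linearLoss (W : Fin k → Fin d → ℝ) :
    Integrable (fun z => linearLoss lhat W z.1 z.2) (mixtureDist P μ σ) :=
  integrable_mixtureDist fun y => integrable_linearLoss_diagGaussian hg hlip W y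

/-- The exponential moment of the centred loss on one sample, for a balanced loss. -/
lemma integral_exp_risk_sub_linearLoss_le {α C : ℝ} (hα : 0 ≤ α)
    (hαC : ∀ y i, (α * g * σ y i) ^ 2 ≤ C) (hbal : PerLabelBalanced lhat μ σ α)
    (W : Fin k → Fin d → ℝ) :
    Integrable (fun z => Real.exp (α * (risk lhat (mixtureDist P μ σ) W
      - linearLoss lhat W z.1 z.2))) (mixtureDist P μ σ) ∧
    ∫ z, Real.exp (α * (risk lhat (mixtureDist P μ σ) W - linearLoss lhat W z.1 z.2))
      ∂(mixtureDist P μ σ) ≤ Real.exp (C * ∑ j, ∑ i, W j i ^ 2) := by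
  set R := risk lhat (mixtureDist P μ σ) W with hR
  have he : (fun z : (Fin d → ℝ) × Fin k => Real.exp (α * (R - linearLoss lhat W z.1 z.2))) =
      fun z => Real.exp (α * R) * Real.exp (-α * linearLoss lhat W z.1 z.2) := by
    funext z
    rw [← Real.exp_add]
    ring_nf
  have hint := fun y => integrable_exp_linearLoss_diagGaussian (μ := μ) (σ := σ) hg hlip hα W y
  rw [he]
  refine ⟨(integrable_mixtureDist
    (h := fun z => Real.exp (-α * linearLoss lhat W z.1 z.2)) hint).const_mul _, ?_⟩
  rw [integral_const_mul, integral_mixtureDist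
    (h := fun z => Real.exp (-α * linearLoss lhat W z.1 z.2)) hint]
  obtain ⟨c, hc⟩ := hbal W
  simp only [hc]
  rw [← Finset.sum_mul, PMF.sum_toReal_eq_one, one_mul]
  -- Some label exists, so `c` is a genuine exponential moment and its logarithm makes sense.
  obtain ⟨y₀, -⟩ := P.support_nonempty
  have hcpos : 0 < c := hc y₀ ▸ integral_exp_pos (hint y₀)
  set E : Fin k → ℝ := fun y => ∫ x, linearLoss lhat W x y ∂(diagGaussian (μ y) (σ y))
  have hRE : R = ∑ y, (P y).toReal * E y := by
    rw [hR, risk]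
    exact integral_mixtureDist (h := fun z => linearLoss lhat W z.1 z.2)
      fun y => integrable_linearLoss_diagGaussian hg hlip W y
  have hy (y : Fin k) : Real.log c ≤ -α * E y + C * ∑ j, ∑ i, W j i ^ 2 := by
    rw [Real.log_le_iff_le_exp hcpos, ← hc y]
    refine (integral_exp_le_pi_gaussianReal _ _ _ _
      (abs_neg_mul_linearLoss_sub_le hg hlip hα W y)).trans (Real.exp_le_exp.2 ?_)
    rw [integral_const_mul, Finset.sum_comm, Finset.mul_sum]
    refine add_le_add le_rfl (Finset.sum_le_sum fun i _ => ?_)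
    rw [← colNorm_sq, NNReal.coe_pow]
    calc (α * (g * colNorm W i)) ^ 2 * (σ y i : ℝ) ^ 2
        = (α * g * σ y i) ^ 2 * colNorm W i ^ 2 := by ring
      _ ≤ C * colNorm W i ^ 2 := by gcongr; exact hαC y i
  -- Averaging with the label weights: the left side is constant by balance, and the means `E y`
  -- average to `R`.
  have hsum : Real.log c ≤ -α * R + C * ∑ j, ∑ i, W j i ^ 2 := by
    calc Real.log c = ∑ y, (P y).toReal * Real.log c := by
          rw [← Finset.sum_mul, PMF.sum_toReal_eq_one, one_mul]
      _ ≤ ∑ y, (P y).toReal * (-α * E y + C * ∑ j, ∑ i, W j i ^ 2) := by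
          gcongr with y
          exact hy y
      _ = -α * R + C * ∑ j, ∑ i, W j i ^ 2 := by
          simp only [mul_add]
          rw [Finset.sum_add_distrib, ← Finset.sum_mul, PMF.sum_toReal_eq_one, one_mul, hRE]
          congr 1
          rw [Finset.mul_sum]
          exact Finset.sum_congr rfl fun y _ => by ring
  calc Real.exp (α * R) * c = Real.exp (α * R) * Real.exp (Real.log c) := by
        rw [Real.exp_log hcpos]
    _ ≤ Real.exp (C * ∑ j, ∑ i, W j i ^ 2) := by
        rw [← Real.exp_add]
        exact Real.exp_le_exp.2 (by linarith)

/-- The exponential moment of the generalization gap of a fixed weight array. -/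
lemma integral_exp_risk_sub_empRisk_le (hm : 0 < m) {lam C : ℝ} (hlam : 0 ≤ lam)
    (hC : ∀ y i, (lam / m * g * σ y i) ^ 2 ≤ C) (hbal : PerLabelBalanced lhat μ σ (lam / m))
    (W : Fin k → Fin d → ℝ) :
    Integrable (fun S => Real.exp (lam * (risk lhat (mixtureDist P μ σ) W - empRisk lhat S W)))
      (Measure.pi fun _ : Fin m => mixtureDist P μ σ) ∧
    ∫ S, Real.exp (lam * (risk lhat (mixtureDist P μ σ) W - empRisk lhat S W))
      ∂(Measure.pi fun _ : Fin m => mixtureDist P μ σ) ≤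
        Real.exp (m * C * ∑ j, ∑ i, W j i ^ 2) := by
  have hm' : (m : ℝ) ≠ 0 := by positivity
  obtain ⟨h1, h2⟩ := integral_exp_risk_sub_linearLoss_le (P := P) hg hlip
    (div_nonneg hlam m.cast_nonneg) hC hbal W
  generalize risk lhat (mixtureDist P μ σ) W = R at h1 h2 ⊢
  set F : (Fin d → ℝ) × Fin k → ℝ := fun z =>
    Real.exp (lam / m * (R - linearLoss lhat W z.1 z.2)) with hF
  have he : (fun S : Fin m → (Fin d → ℝ) × Fin k => Real.exp (lam * (R - empRisk lhat S W))) =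
      fun S => ∏ i, F (S i) := by
    funext S
    rw [hF, ← Real.exp_sum, ← Finset.mul_sum, Finset.sum_sub_distrib, empRisk]
    congr 1
    simp
    field_simp
  rw [he]
  refine ⟨Integrable.fintype_prod (f := fun _ => F) fun _ => h1, ?_⟩
  rw [integral_fintype_prod_eq_pow F, Fintype.card_fin, mul_assoc, Real.exp_nat_mul]
  exact pow_le_pow_left₀ (integral_nonneg fun z => (Real.exp_pos _).le) h2 m

end Lipschitz

/-- A function of the weights of at most linear growth is integrable under every posterior of
finite relative entropy with respect to the Gaussian prior. -/
lemma integrable_of_abs_le_entries {s : ℝ≥0} {q : Measure (Fin k → Fin d → ℝ)}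
    [IsProbabilityMeasure q] (hkl : InformationTheory.klDiv q (gaussianPrior k d s) ≠ ∞)
    {φ : (Fin k → Fin d → ℝ) → ℝ} (hφ : Measurable φ) (a : ℝ) (b : Fin d → ℝ)
    (h : ∀ W, |φ W| ≤ a + ∑ i, b i * ∑ j, |W j i|) : Integrable φ q := by
  refine Integrable.mono' (g := fun W => a + ∑ i, b i * ∑ j, |W j i|) ?_ hφ.aestronglyMeasurable
    (Filter.Eventually.of_forall h)
  refine (integrable_const _).add (integrable_finsetSum _ fun i _ => Integrable.const_mul
    (integrable_finsetSum _ fun j _ => Integrable.abs ?_) _)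
  exact integrable_of_klDiv_ne_top (φ := fun W => W j i) hkl
    (Measurable.aestronglyMeasurable (by fun_prop)) (integrable_exp_abs_entry j i)

lemma integrable_empRisk (hg : 0 ≤ g) (hlip : ∀ y s t, |lhat s y - lhat t y| ≤ g * ‖s - t‖)
    (hlhat : ∀ y, Continuous fun t => lhat t y) (S : Fin m → (Fin d → ℝ) × Fin k)
    {s : ℝ≥0} {q : Measure (Fin k → Fin d → ℝ)} [IsProbabilityMeasure q]
    (hkl : InformationTheory.klDiv q (gaussianPrior k d s) ≠ ∞) :
    Integrable (empRisk lhat S) q := by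
  refine Integrable.const_mul (integrable_finsetSum _ fun l _ => ?_) _
  refine integrable_of_abs_le_entries hkl
    ((measurable_linearLoss hlhat).comp measurable_prodMk_right) |lhat 0 (S l).2|
    (fun i => g * |(S l).1 i|) fun W => (abs_linearLoss_le hg (hlip _) W _).trans_eq ?_
  congr 1
  exact Finset.sum_congr rfl fun i _ => by ring

/-- Averaging the linear growth bound on the loss over the data leaves linear growth in the entries
of `W`, because the Gaussian coordinates have finite first absolute moments. -/
lemma integrable_risk (hg : 0 ≤ g) (hlip : ∀ y s t, |lhat s y - lhat t y| ≤ g * ‖s - t‖)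
    (hlhat : ∀ y, Continuous fun t => lhat t y)
    {s : ℝ≥0} {q : Measure (Fin k → Fin d → ℝ)} [IsProbabilityMeasure q]
    (hkl : InformationTheory.klDiv q (gaussianPrior k d s) ≠ ∞) :
    Integrable (risk lhat (mixtureDist P μ σ)) q := by
  have hx (i : Fin d) : Integrable (fun z : (Fin d → ℝ) × Fin k => |z.1 i|) (mixtureDist P μ σ) :=
    integrable_mixtureDist fun y => integrable_comp_eval
      (μ := fun i => gaussianReal (μ y i) (σ y i ^ 2)) (f := fun t : ℝ => |t|)
      (integrable_abs_gaussianReal _ _)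
  have h0 : Integrable (fun z : (Fin d → ℝ) × Fin k => |lhat 0 z.2|) (mixtureDist P μ σ) :=
    integrable_mixtureDist fun y => integrable_const |lhat 0 y|
  refine integrable_of_abs_le_entries hkl (measurable_risk hlhat _)
    (∫ z, |lhat 0 z.2| ∂(mixtureDist P μ σ)) (fun i => g * ∫ z, |z.1 i| ∂(mixtureDist P μ σ))
    fun W => ?_
  have hsum : Integrable (fun z : (Fin d → ℝ) × Fin k => ∑ i, g * (∑ j, |W j i|) * |z.1 i|)
      (mixtureDist P μ σ) := integrable_finsetSum _ fun i _ => (hx i).const_mul _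
  refine (norm_integral_le_of_norm_le
    (f := fun z : (Fin d → ℝ) × Fin k => linearLoss lhat W z.1 z.2)
    (g := fun z => |lhat 0 z.2| + ∑ i, g * (∑ j, |W j i|) * |z.1 i|) (h0.add hsum)
    (Filter.Eventually.of_forall fun z => abs_linearLoss_le hg (hlip z.2) W z.1)).trans_eq ?_
  rw [integral_add h0 hsum, integral_finsetSum _ fun i _ => (hx i).const_mul _]
  congr 1
  refine Finset.sum_congr rfl fun i _ => ?_
  rw [integral_const_mul]
  ring

end LinearModel

/-! ### Assembling the bound -/

theorem mainTheorem2 {d k m : ℕ} (hm : 0 < m)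
    (P : PMF (Fin k)) (μ : Fin k → Fin d → ℝ) (σ : Fin k → Fin d → ℝ≥0)
    (lhat : EuclideanSpace ℝ (Fin k) → Fin k → ℝ) (g : ℝ)
    (hdiff : ∀ y, Differentiable ℝ (fun t => lhat t y))
    (hgrad : ∀ y t, ‖∇ (fun s => lhat s y) t‖ ≤ g)
    (σp : ℝ≥0) (hσp : 0 < σp)
    (lam : ℝ) (hlam : 0 < lam)
    (hlam_le : ∀ y i, lam * (g * σp * σ y i) ≤ Real.sqrt (m / 16))
    (hbal : ∀ α ∈ Set.Ioc (0 : ℝ) (lam / m), PerLabelBalanced lhat μ σ α)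
    (δ : ℝ) (hδ : δ ∈ Set.Ioo (0 : ℝ) 1) :
    (∀ W : Fin k → Fin d → ℝ,
      Integrable (fun z => linearLoss lhat W z.1 z.2) (mixtureDist P μ σ)) ∧
    ∃ G : Set (Fin m → (Fin d → ℝ) × Fin k), MeasurableSet G ∧
      ENNReal.ofReal (1 - δ) ≤ Measure.pi (fun _ : Fin m => mixtureDist P μ σ) G ∧
      ∀ S ∈ G, ∀ q : Measure (Fin k → Fin d → ℝ), IsProbabilityMeasure q →
        InformationTheory.klDiv q (gaussianPrior k d σp) ≠ ∞ →
        Integrable (risk lhat (mixtureDist P μ σ)) q ∧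
        Integrable (empRisk lhat S) q ∧
        ∫ W, risk lhat (mixtureDist P μ σ) W ∂q ≤ ∫ W, empRisk lhat S W ∂q +
          ((k : ℝ) * d * Real.log (Real.sqrt (4 / 3))
            + (InformationTheory.klDiv q (gaussianPrior k d σp)).toReal
            + Real.log (1 / δ)) / lam := by
  obtain ⟨y₀, -⟩ := P.support_nonempty
  have hg : 0 ≤ g := (norm_nonneg _).trans (hgrad y₀ 0)
  have hlip (y : Fin k) (s t : EuclideanSpace ℝ (Fin k)) :
      |lhat s y - lhat t y| ≤ g * ‖s - t‖ :=
    abs_sub_le_of_norm_gradient_le (hdiff y) (hgrad y) s t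
  have hlhat (y : Fin k) : Continuous fun t => lhat t y := (hdiff y).continuous
  have hm' : (0 : ℝ) < m := Nat.cast_pos.2 hm
  have hσp' : (0 : ℝ) < σp := hσp
  -- The hypothesis on `lam` would even give `1 / (16 σp² m)`; the weaker constant matches the prior
  -- moment that produces `√(4/3)`.
  have hC (y : Fin k) (i : Fin d) :
      (lam / m * g * σ y i) ^ 2 ≤ 1 / (8 * (σp : ℝ) ^ 2) / m := by
    have h0 : 0 ≤ lam * (g * σp * σ y i) := by positivity
    have h := pow_le_pow_left₀ h0 (hlam_le y i) 2
    rw [Real.sq_sqrt (by positivity)] at h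
    rw [div_div, le_div_iff₀ (by positivity)]
    have e : (lam / m * g * σ y i) ^ 2 * (8 * (σp : ℝ) ^ 2 * m) =
        8 * (lam * (g * σp * σ y i)) ^ 2 / m := by
      field_simp
    rw [e, div_le_iff₀ hm']
    linarith
  have hbal' := hbal (lam / m) ⟨by positivity, le_rfl⟩
  refine ⟨integrable_linearLoss hg hlip, ?_⟩
  have hmom := integral_exp_risk_sub_empRisk_le (P := P) hg hlip hm hlam.le hC hbal'
  have hexp (W : Fin k → Fin d → ℝ) :
      (m : ℝ) * (1 / (8 * (σp : ℝ) ^ 2) / m) * ∑ j, ∑ i, W j i ^ 2 =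
        ∑ j, ∑ i, W j i ^ 2 / (8 * (σp : ℝ) ^ 2) := by
    rw [mul_div_cancel₀ _ hm'.ne']
    simp only [Finset.mul_sum]
    exact Finset.sum_congr rfl fun j _ => Finset.sum_congr rfl fun i _ => by ring
  simp only [hexp] at hmom
  obtain ⟨hbint, hbval⟩ := integral_exp_sum_sq_gaussianPrior (k := k) (d := d) hσp
  have hmeas : Measurable (Function.uncurry fun (S : Fin m → (Fin d → ℝ) × Fin k)
      (W : Fin k → Fin d → ℝ) =>
        lam * (risk lhat (mixtureDist P μ σ) W - empRisk lhat S W)) :=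
    (((measurable_risk hlhat _).comp measurable_snd).sub (measurable_empRisk hlhat)).const_mul _
  obtain ⟨G, hGm, hG, hGS⟩ := exists_measurableSet_log_integral_exp_le
    (Measure.pi fun _ : Fin m => mixtureDist P μ σ) (gaussianPrior k d σp) hmeas hbint
    (fun W => (hmom W).1) (fun W => (hmom W).2) hδ.1
  refine ⟨G, hGm, hG, fun S hS q _ hkl => ?_⟩
  obtain ⟨hi, hlog⟩ := hGS S hS
  have hri : Integrable (risk lhat (mixtureDist P μ σ)) q := integrable_risk hg hlip hlhat hkl
  have hei : Integrable (empRisk lhat S) q := integrable_empRisk hg hlip hlhat S hkl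
  refine ⟨hri, hei, ?_⟩
  -- The posterior `q` enters only here, after `G` has been fixed.
  have hdv := integral_le_klDiv_add_log_integral_exp hkl ((hri.sub hei).const_mul lam) hi
  simp only [Pi.sub_apply] at hdv
  rw [integral_const_mul, integral_sub hri hei] at hdv
  rw [hbval, div_eq_mul_one_div, Real.log_mul (by positivity) (one_div_pos.2 hδ.1).ne',
    Real.log_pow] at hlog
  push_cast at hlog
  rw [← sub_le_iff_le_add', le_div_iff₀ hlam]
  linarith
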